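/- Call a set $A \subseteq \mathbb R^d$ a \emph{polyhedron} if its boundary $\partial A$ can be covered by finitely many (affine) hyperplanes. Let $\lambda$ denote Lebesgue measure on $\mathbb R^d$ and $|\cdot|$ the Euclidean norm. A bounded measurable set $A \subseteq \mathbb R^d$ is called \emph{measure Kolmogorov} if for every $\varepsilon > 0$ there is a 1-Lipschitz map $f : A \to \mathbb R^d$ such that $f(A)$ is a polyhedron and $\lambda(f(A)) > \lambda(A) - \varepsilon$. A bounded set $A \subseteq \mathbb R^d$ is called \emph{distance Kolmogorov} if for every $\varepsilon > 0$ there is a 1-Lipschitz map $f : A \to \mathbb R^d$ such that $f(A)$ is a polyhedron and $|f(x) - x| \le \varepsilon$ for every $x \in A$. Then for every $d \ge 2$, the following are equivalent: 1. Every compact set $K \subseteq \mathbb R^d$ is measure Kolmogorov. 2. Every compact set $K \subseteq \mathbb R^d$ is distance Kolmogorov. -/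

import Mathlib

open MeasureTheory

namespace KolmogorovProblem

/-- An (affine) hyperplane of `ℝ^d`: the solution set of `⟪v, x⟫ = c` for some `v ≠ 0`. -/
def IsHyperplane {d : ℕ} (H : Set (EuclideanSpace ℝ (Fin d))) : Prop :=
  ∃ (v : EuclideanSpace ℝ (Fin d)) (c : ℝ), v ≠ 0 ∧ H = {x | inner ℝ v x = c}

/-- A set is a polyhedron if its boundary can be covered by finitely many hyperplanes. -/
def IsPolyhedron {d : ℕ} (A : Set (EuclideanSpace ℝ (Fin d))) : Prop :=
  ∃ S : Set (Set (EuclideanSpace ℝ (Fin d))),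
    S.Finite ∧ (∀ H ∈ S, IsHyperplane H) ∧ frontier A ⊆ ⋃₀ S

/-- A bounded (Lebesgue) measurable set `A` is measure Kolmogorov if for every `ε > 0` there is
a 1-Lipschitz map `f` on `A` such that `f(A)` is a polyhedron and `λ(f(A)) > λ(A) - ε`.
The values of `f` outside `A` play no role. Both measures are finite, since `A` and `f(A)` are
bounded, so that the real-valued measure loses nothing. -/
def IsMeasureKolmogorov {d : ℕ} (A : Set (EuclideanSpace ℝ (Fin d))) : Prop :=
  Bornology.IsBounded A ∧ NullMeasurableSet A volume ∧
    ∀ ε : ℝ, 0 < ε → ∃ f : EuclideanSpace ℝ (Fin d) → EuclideanSpace ℝ (Fin d),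
      LipschitzOnWith 1 f A ∧ IsPolyhedron (f '' A) ∧
        volume.real (f '' A) > volume.real A - ε

/-- A bounded set `A` is distance Kolmogorov if for every `ε > 0` there is a 1-Lipschitz map `f`
on `A` such that `f(A)` is a polyhedron and `|f(x) - x| ≤ ε` for every `x ∈ A`.
The values of `f` outside `A` play no role. -/
def IsDistanceKolmogorov {d : ℕ} (A : Set (EuclideanSpace ℝ (Fin d))) : Prop :=
  Bornology.IsBounded A ∧
    ∀ ε : ℝ, 0 < ε → ∃ f : EuclideanSpace ℝ (Fin d) → EuclideanSpace ℝ (Fin d),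
      LipschitzOnWith 1 f A ∧ IsPolyhedron (f '' A) ∧ ∀ x ∈ A, ‖f x - x‖ ≤ ε

end KolmogorovProblem

namespace KolmogorovProblem

/-! ### Lipschitz degree theory: no retraction onto the sphere -/

section Degree

open Metric Set Filter
open scoped NNReal ENNReal Topology

variable {E : Type*} [NormedAddCommGroup E] [InnerProductSpace ℝ E] [FiniteDimensional ℝ E]

/-! Distance implies measure, for each compact `K` separately. Extend a map `f` of `K` that moves
points very little to a Lipschitz map `F` of the whole space. Around almost every point of `K`, the
set `K` is so dense at small scales that `F` too moves points of a small ball by at most half its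
radius; a Brouwer type argument then puts the centre in the image of `F`. Hence `F` of a
neighbourhood of `K` has almost full measure, and the part outside `K` contributes little. The
carriers are `mem_image_closedBall_of_norm_sub_le` and Lebesgue's density theorem.

Measure implies distance uses the hypothesis for a larger compact set: `K` together with a thick
annulus around it. Maps that lose less and less measure converge to a 1-Lipschitz map preserving the
volume of the annulus. Such a map is an affine isometry on the open annulus
(`exists_affineIsometryEquiv_eqOn`). After undoing the isometry the annulus is fixed, and so is
every point of `K`, being the midpoint of two fixed points. Thus some map in the sequence is, up to
an isometry, close to the identity on `K`; the image of `K` stays away from that of the annulus, so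
it inherits being a polyhedron. -/

theorem det_id_add_eq_sum {ι : Type*} [DecidableEq ι] (s : Finset ι) (v : ι → ℝ)
    (hv : Set.InjOn v s) (hs : Module.finrank ℝ E < s.card) (A : E →L[ℝ] E) :
    (ContinuousLinearMap.id ℝ E + A).det =
      ∑ j ∈ s, (ContinuousLinearMap.id ℝ E + v j • A).det * (Lagrange.basis s v j).eval 1 := by
  classical
  let b := Module.finBasis ℝ E
  let M := LinearMap.toMatrix b b A.toLinearMap
  let p : Polynomial ℝ := Matrix.det ((Polynomial.X : Polynomial ℝ) • M.map Polynomial.C +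
    (1 : Matrix _ _ ℝ).map Polynomial.C)
  have hp : ∀ t : ℝ, p.eval t = (ContinuousLinearMap.id ℝ E + t • A).det := by
    intro t
    rw [ContinuousLinearMap.det, ← LinearMap.det_toMatrix b, ← Polynomial.coe_evalRingHom,
      RingHom.map_det]
    congr 1
    ext i j
    simp [M, Matrix.one_apply, LinearMap.toMatrix_apply, Finsupp.single_apply, eq_comm]
    split_ifs <;> simp <;> ring
  have hdeg : p.degree < s.card := by
    refine lt_of_le_of_lt Polynomial.degree_le_natDegree ?_
    have := Polynomial.natDegree_det_X_add_C_le M 1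
    rw [Fintype.card_fin] at this
    exact_mod_cast lt_of_le_of_lt this hs
  have := congrArg (Polynomial.eval 1) (Lagrange.eq_interpolate hv hdeg)
  rw [hp, Lagrange.interpolate_apply, Polynomial.eval_finsetSum] at this
  simpa [hp] using this

variable [MeasurableSpace E] [BorelSpace E]

theorem addHaar_image_le_of_lipschitzOnWith (μ : Measure E) [μ.IsAddHaarMeasure] {C : ℝ≥0}
    {f : E → E} {s : Set E} (hf : LipschitzOnWith C f s) :
    μ (f '' s) ≤ (C : ℝ≥0∞) ^ (Module.finrank ℝ E) * μ s := by
  have h := hf.hausdorffMeasure_image_le (d := (Module.finrank ℝ E : ℝ)) (by positivity)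
  rw [Measure.isAddLeftInvariant_eq_smul μ (μH[(Module.finrank ℝ E : ℝ)] : Measure E)]
  simp only [Measure.smul_apply, ENNReal.smul_def, smul_eq_mul]
  rw [ENNReal.rpow_natCast] at h
  rw [mul_left_comm]
  gcongr

/-- For small `t` the map `id + t • g` is a bijection of the ball with positive Jacobian, so the
area formula computes the integral. -/
theorem integral_det_id_add_smul_fderiv (μ : Measure E) [μ.IsAddHaarMeasure] {g : E → E}
    {L : ℝ≥0} (hg : LipschitzWith L g) {R : ℝ} (hR : ∀ x ∉ ball (0 : E) R, g x = 0) :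
    ∃ t₀ : ℝ, 0 < t₀ ∧ ∀ t ∈ Ioo 0 t₀,
      ∫ x in ball (0 : E) R, (ContinuousLinearMap.id ℝ E + t • fderiv ℝ g x).det ∂μ =
        μ.real (ball (0 : E) R) := by
  have hdet : ∀ᶠ A : E →L[ℝ] E in 𝓝 (ContinuousLinearMap.id ℝ E), 0 < A.det := by
    refine (ContinuousLinearMap.continuous_det (E := E) (𝕜 := ℝ)).continuousAt.eventually_mem ?_
    refine lt_mem_nhds ?_
    simp [ContinuousLinearMap.det]
  obtain ⟨δ, hδ, hball⟩ := Metric.eventually_nhds_iff_ball.1 hdet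
  -- The first bound keeps the determinant positive, the second makes `t * L < 1`, hence `id + t •
  -- g` bijective. Adding 1 to `L` covers `L = 0`.
  refine ⟨min (δ / (L + 1)) (1 / (L + 1)), by positivity, fun t ht => ?_⟩
  have ht0 := ht.1
  have ht1 : t * (L + 1) < δ := by
    have := ht.2.trans_le (min_le_left _ _)
    rwa [lt_div_iff₀ (by positivity)] at this
  have ht2 : t * (L + 1) < 1 := by
    have := ht.2.trans_le (min_le_right _ _)
    rwa [lt_div_iff₀ (by positivity)] at this
  have hpos : ∀ x, 0 < (ContinuousLinearMap.id ℝ E + t • fderiv ℝ g x).det := by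
    intro x
    apply hball
    rw [mem_ball, dist_eq_norm, add_sub_cancel_left, norm_smul, Real.norm_of_nonneg ht0.le]
    have := norm_fderiv_le_of_lipschitz ℝ hg (x₀ := x)
    nlinarith [L.coe_nonneg]
  set f : E → E := fun x => x + t • g x with hf
  have hmono : ∀ x y, (1 - t * L) * dist x y ≤ dist (f x) (f y) := by
    intro x y
    have h1 := hg.dist_le_mul x y
    rw [dist_eq_norm, dist_eq_norm] at *
    have h2 : f x - f y = (x - y) + t • (g x - g y) := by simp only [hf, smul_sub]; abel
    have h3 := norm_sub_norm_le (x - y) (-(t • (g x - g y)))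
    rw [sub_neg_eq_add, norm_neg, norm_smul, Real.norm_of_nonneg ht0.le] at h3
    rw [h2]
    nlinarith
  have htL : t * L < 1 := by nlinarith [L.coe_nonneg]
  have hinj : Function.Injective f := by
    intro x y hxy
    have := hmono x y
    rw [hxy, dist_self] at this
    exact dist_le_zero.1 (nonpos_of_mul_nonpos_right this (by linarith))
  have hfL : LipschitzWith (1 + t.toNNReal * L) f :=
    LipschitzWith.id.add ((lipschitzWith_smul t).comp hg |>.weaken (by
      gcongr; rw [Real.toNNReal_of_nonneg ht0.le]; exact le_of_eq (by ext; simp [abs_of_pos ht0])))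
  have hsurj : Function.Surjective f := by
    have hA : ApproximatesLinearOn f
        ((ContinuousLinearEquiv.refl ℝ E : E ≃L[ℝ] E) : E →L[ℝ] E) univ (t.toNNReal * L) := by
      refine LipschitzOnWith.approximatesLinearOn ?_
      rw [lipschitzOnWith_univ]
      refine LipschitzWith.of_dist_le_mul fun x y => ?_
      have h1 := hg.dist_le_mul x y
      simp only [hf, Pi.sub_apply, ContinuousLinearEquiv.coe_refl,
        ContinuousLinearMap.coe_id', id, add_sub_cancel_left]
      rw [dist_smul₀, Real.norm_of_nonneg ht0.le]
      push_cast
      rw [Real.coe_toNNReal _ ht0.le, mul_assoc]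
      gcongr
    refine hA.surjective ?_
    rcases subsingleton_or_nontrivial E with hE | hE
    · exact Or.inl hE
    · right
      simp only [ContinuousLinearEquiv.refl_symm, ContinuousLinearEquiv.coe_refl]
      rw [← NNReal.coe_lt_coe]
      simp [ht0.le, htL]
  have himage : f '' ball 0 R = ball 0 R := by
    have hid : ∀ x ∉ ball (0 : E) R, f x = x := fun x hx => by simp [hf, hR x hx]
    apply Subset.antisymm
    · rintro _ ⟨x, hx, rfl⟩
      by_contra h
      exact h ((hinj (hid _ h)).symm ▸ hx)
    · intro y hy
      obtain ⟨x, rfl⟩ := hsurj y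
      refine ⟨x, ?_, rfl⟩
      by_contra h
      rw [hid x h] at hy
      exact h hy
  let D := {x | DifferentiableAt ℝ g x}
  have hD : MeasurableSet D := measurableSet_of_differentiableAt ℝ g
  have hDae : ∀ᵐ x ∂μ, x ∈ D := hg.ae_differentiableAt
  have hfd : ∀ x ∈ ball 0 R ∩ D, HasFDerivWithinAt f
      (ContinuousLinearMap.id ℝ E + t • fderiv ℝ g x) (ball 0 R ∩ D) x := fun x hx =>
    ((hasFDerivAt_id x).add (hx.2.hasFDerivAt.const_smul t)).hasFDerivWithinAt
  have harea := lintegral_abs_det_fderiv_eq_addHaar_image μ (measurableSet_ball.inter hD) hfd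
    hinj.injOn
  have hDnull : μ (ball 0 R \ D) = 0 :=
    measure_mono_null (fun x hx => hx.2) (mem_ae_iff.1 hDae)
  have himD : μ (f '' (ball 0 R ∩ D)) = μ (ball 0 R) := by
    apply le_antisymm
    · exact measure_mono ((image_mono inter_subset_left).trans himage.subset)
    · calc μ (ball 0 R) = μ (f '' (ball 0 R ∩ D) ∪ f '' (ball 0 R \ D)) := by
            rw [← image_union, inter_union_sdiff, himage]
        _ ≤ μ (f '' (ball 0 R ∩ D)) + μ (f '' (ball 0 R \ D)) := measure_union_le _ _
        _ ≤ μ (f '' (ball 0 R ∩ D)) + 0 := by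
            gcongr
            refine (addHaar_image_le_of_lipschitzOnWith μ hfL.lipschitzOnWith).trans ?_
            rw [hDnull, mul_zero]
        _ = _ := add_zero _
  have hmeas : Measurable fun x => (ContinuousLinearMap.id ℝ E + t • fderiv ℝ g x).det :=
    ContinuousLinearMap.continuous_det.measurable.comp
      (((measurable_fderiv ℝ g).const_smul t).const_add _)
  rw [integral_eq_lintegral_of_nonneg_ae (Eventually.of_forall fun x => (hpos x).le)
    hmeas.aestronglyMeasurable, Measure.real, ← himD, ← harea]
  congr 1
  have : (μ.restrict (ball 0 R)) = μ.restrict (ball 0 R ∩ D) := by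
    refine Measure.restrict_congr_set ?_
    filter_upwards [hDae] with x hx
    exact propext ⟨fun h => ⟨h, hx⟩, fun h => h.1⟩
  rw [← this]
  exact lintegral_congr fun x => by rw [abs_of_pos (hpos x)]

/-- The integral of `det (id + t • Dg)` is a polynomial in `t` of degree at most the dimension.
Being constant for small `t > 0`, it has the same value at `t = 1`; Lagrange interpolation at small
nodes makes this explicit. -/
theorem integral_det_id_add_fderiv (μ : Measure E) [μ.IsAddHaarMeasure] {g : E → E}
    {L : ℝ≥0} (hg : LipschitzWith L g) {R : ℝ} (hR0 : 0 < R)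
    (hR : ∀ x ∉ ball (0 : E) R, g x = 0) :
    ∫ x in ball (0 : E) R, (ContinuousLinearMap.id ℝ E + fderiv ℝ g x).det ∂μ =
      μ.real (ball (0 : E) R) := by
  obtain ⟨t₀, ht₀, h⟩ := integral_det_id_add_smul_fderiv μ hg hR
  let n := Module.finrank ℝ E
  let v : ℕ → ℝ := fun j => t₀ / (j + 2)
  have hv : ∀ j, v j ∈ Ioo 0 t₀ := fun j => by
    refine ⟨by positivity, ?_⟩
    simp only [v]
    rw [div_lt_iff₀ (by positivity)]
    nlinarith [(Nat.cast_nonneg j : (0 : ℝ) ≤ j)]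
  have hvinj : Set.InjOn v (Finset.range (n + 1)) := by
    intro i _ j _ hij
    simp only [v] at hij
    rw [div_eq_div_iff (by positivity) (by positivity)] at hij
    have := mul_left_cancel₀ ht₀.ne' hij
    exact_mod_cast (add_right_cancel this).symm
  have hballpos : 0 < μ.real (ball (0 : E) R) :=
    ENNReal.toReal_pos (measure_ball_pos μ 0 hR0).ne' measure_ball_lt_top.ne
  have hint : ∀ j, IntegrableOn
      (fun x => (ContinuousLinearMap.id ℝ E + v j • fderiv ℝ g x).det) (ball 0 R) μ := fun j => by
    -- Non-integrable functions have integral zero by convention, so a nonzero integral gives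
    -- integrability.
    refine Integrable.of_integral_ne_zero ?_
    rw [h _ (hv j)]
    exact hballpos.ne'
  have hcard : Module.finrank ℝ E < (Finset.range (n + 1)).card := by simp [n]
  rw [integral_congr_ae (Eventually.of_forall fun x =>
    det_id_add_eq_sum (Finset.range (n + 1)) v hvinj hcard (fderiv ℝ g x))]
  rw [integral_finsetSum _ fun j _ => (hint j).mul_const _]
  simp_rw [integral_mul_const, h _ (hv _), ← Finset.mul_sum]
  rw [← Polynomial.eval_finsetSum, Lagrange.sum_basis hvinj (by simp)]
  simp

/-- A Lipschitz map that is the identity off a ball does not map the ball to its boundary. -/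
theorem exists_norm_ne_of_lipschitzWith_of_eq_id {h : E → E} {L : ℝ≥0} (hL : LipschitzWith L h)
    {R : ℝ} (hR : 0 < R) (hid : ∀ x ∉ ball (0 : E) R, h x = x) :
    ∃ x ∈ ball (0 : E) R, ‖h x‖ ≠ R := by
  by_contra! hno
  let g : E → E := fun x => h x - x
  have hg : LipschitzWith (L + 1) g := hL.sub LipschitzWith.id
  have hint := integral_det_id_add_fderiv (volume : Measure E) hg hR fun x hx => by
    simp [g, hid x hx]
  have hballpos : 0 < volume.real (ball (0 : E) R) :=
    ENNReal.toReal_pos (measure_ball_pos volume 0 hR).ne' measure_ball_lt_top.ne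
  refine hballpos.ne' (hint.symm.trans ?_)
  refine integral_eq_zero_of_ae ?_
  filter_upwards [ae_restrict_of_ae hL.ae_differentiableAt, ae_restrict_mem measurableSet_ball]
    with x hx hxR
  have hfd : ContinuousLinearMap.id ℝ E + fderiv ℝ g x = fderiv ℝ h x := by
    have : fderiv ℝ g x = fderiv ℝ h x - ContinuousLinearMap.id ℝ E :=
      (hx.hasFDerivAt.sub (hasFDerivAt_id x)).fderiv
    rw [this]; abel
  rw [hfd]
  -- Differentiating the constant `‖h‖ ^ 2` shows that the range of the derivative is orthogonal to
  -- `h x ≠ 0`, so the determinant vanishes almost everywhere.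
  have hperp : ∀ v, inner ℝ (h x) (fderiv ℝ h x v) = (0 : ℝ) := by
    intro v
    have h1 := hx.hasFDerivAt.norm_sq
    have h2 : (fun y => ‖h y‖ ^ 2) =ᶠ[𝓝 x] fun _ => R ^ 2 := by
      filter_upwards [isOpen_ball.mem_nhds hxR] with y hy
      rw [hno y hy]
    have h3 := h1.unique ((hasFDerivAt_const (R ^ 2) x).congr_of_eventuallyEq h2)
    have h4 := congrArg (fun A => A v) h3
    simpa using h4
  by_contra hdet
  have hsurj : Function.Surjective (fderiv ℝ h x) := by
    have hu : IsUnit (LinearMap.det (fderiv ℝ h x).toLinearMap) := isUnit_iff_ne_zero.2 hdet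
    have := (LinearMap.isUnit_iff_isUnit_det _).2 hu
    exact ((Module.End.isUnit_iff _).1 this).2
  obtain ⟨v, hv⟩ := hsurj (h x)
  have := hperp v
  rw [hv, inner_self_eq_zero] at this
  have h5 := hno x hxR
  rw [this, norm_zero] at h5
  exact hR.ne h5

/-- If `F` had no zero, cutting off its displacement and then pushing radially outwards would give a
Lipschitz retraction of a ball onto its sphere. -/
theorem exists_eq_zero_of_norm_sub_le {F : E → E} {L : ℝ≥0} (hF : LipschitzWith L F) {s : ℝ}
    (hs : 0 < s) (hFs : ∀ x ∈ closedBall (0 : E) (2 * s), ‖F x - x‖ ≤ s) :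
    ∃ x ∈ closedBall (0 : E) (2 * s), F x = 0 := by
  by_contra! hne
  let χ : E → ℝ := fun x => min 1 (max 0 (2 - ‖x‖ / s))
  have hχ0 : ∀ x, 0 ≤ χ x := fun x => le_min zero_le_one (le_max_left _ _)
  have hχ1 : ∀ x, χ x ≤ 1 := fun x => min_le_left _ _
  have hχout : ∀ x ∉ closedBall (0 : E) (2 * s), χ x = 0 := by
    intro x hx
    rw [mem_closedBall_zero_iff, not_le] at hx
    have : 2 - ‖x‖ / s ≤ 0 := by rw [sub_nonpos, le_div_iff₀ hs]; exact hx.le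
    simp [χ, this]
  have hχL : ∀ x y, |χ x - χ y| ≤ dist x y / s := by
    intro x y
    have h1 : |χ x - χ y| ≤ |(2 - ‖x‖ / s) - (2 - ‖y‖ / s)| := by
      have h2 := abs_min_sub_min_le_max 1 (max 0 (2 - ‖x‖ / s)) 1 (max 0 (2 - ‖y‖ / s))
      have h3 := abs_max_sub_max_le_max 0 (2 - ‖x‖ / s) 0 (2 - ‖y‖ / s)
      rw [sub_self, abs_zero, max_eq_right (a := (0 : ℝ)) (abs_nonneg _)] at h2 h3
      exact h2.trans h3
    refine h1.trans ?_
    rw [show (2 - ‖x‖ / s) - (2 - ‖y‖ / s) = -((‖x‖ - ‖y‖) / s) by ring, abs_neg, abs_div,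
      abs_of_pos hs, dist_eq_norm]
    gcongr
    exact abs_norm_sub_norm_le x y
  let w : E → E := fun x => χ x • (F x - x)
  have hwle : ∀ x, ‖w x‖ ≤ χ x * s := by
    intro x
    by_cases hx : x ∈ closedBall (0 : E) (2 * s)
    · rw [norm_smul, Real.norm_of_nonneg (hχ0 x)]
      exact mul_le_mul_of_nonneg_left (hFs x hx) (hχ0 x)
    · simp [w, hχout x hx]
  have hwL : LipschitzWith (1 + (L + 1)) w := by
    have key : ∀ x ∈ closedBall (0 : E) (2 * s), ∀ y,
        dist (w x) (w y) ≤ (1 + (L + 1)) * dist x y := by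
      intro x hx y
      have h1 : w x - w y = (χ x - χ y) • (F x - x) + χ y • ((F x - x) - (F y - y)) := by
        simp only [w]; module
      have h2 := (hF.sub LipschitzWith.id).dist_le_mul x y
      rw [dist_eq_norm, dist_eq_norm] at *
      simp only [id, NNReal.coe_add, NNReal.coe_one] at h2
      rw [h1]
      refine (norm_add_le _ _).trans ?_
      rw [norm_smul, norm_smul, Real.norm_of_nonneg (hχ0 y), add_mul, Real.norm_eq_abs]
      have h3 := hχL x y
      rw [dist_eq_norm] at h3
      have h4 := hFs x hx
      refine add_le_add ?_ ?_
      · calc |χ x - χ y| * ‖F x - x‖ ≤ ‖x - y‖ / s * s := by gcongr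
          _ = 1 * ‖x - y‖ := by field_simp
      · calc χ y * _ ≤ 1 * _ := by gcongr; exact hχ1 y
          _ ≤ _ := by rw [one_mul]; exact h2
    refine LipschitzWith.of_dist_le_mul fun x y => ?_
    push_cast
    by_cases hx : x ∈ closedBall (0 : E) (2 * s)
    · exact key x hx y
    by_cases hy : y ∈ closedBall (0 : E) (2 * s)
    · rw [dist_comm, dist_comm x]; exact key y hy x
    · simp only [w, hχout x hx, hχout y hy, zero_smul, dist_self]
      positivity
  let f : E → E := fun x => x + w x
  have hfL : LipschitzWith (1 + (1 + (L + 1))) f := LipschitzWith.id.add hwL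
  have hfout : ∀ x ∉ closedBall (0 : E) (2 * s), f x = x := fun x hx => by
    simp [f, w, hχout x hx]
  -- The displacement is at most `s`, so a zero of `f` has norm at most `s`; there the cutoff is 1
  -- and `f` agrees with `F`.
  have hf0 : ∀ x, f x ≠ 0 := by
    intro x h0
    have h1 : ‖x‖ ≤ χ x * s := by
      have : x = - w x := eq_neg_of_add_eq_zero_left h0
      calc ‖x‖ = ‖w x‖ := by rw [this, norm_neg, ← this]
        _ ≤ _ := hwle x
    have h2 : ‖x‖ ≤ s := h1.trans (mul_le_of_le_one_left hs.le (hχ1 x))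
    have h3 : χ x = 1 := by
      have : 1 ≤ 2 - ‖x‖ / s := by
        have : ‖x‖ / s ≤ 1 := (div_le_one hs).2 h2
        linarith
      simp only [χ]
      rw [max_eq_right (by linarith), min_eq_left this]
    refine hne x (by rw [mem_closedBall_zero_iff]; linarith) ?_
    simpa [f, w, h3] using h0
  obtain ⟨m, hm, hmf⟩ : ∃ m : ℝ, 0 < m ∧ ∀ x, m ≤ ‖f x‖ := by
    obtain ⟨z, -, hz⟩ := (isCompact_closedBall (0 : E) (2 * s)).exists_isMinOn
      (nonempty_closedBall.2 (by positivity)) hfL.continuous.norm.continuousOn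
    refine ⟨min ‖f z‖ s, lt_min (norm_pos_iff.2 (hf0 z)) hs, fun x => ?_⟩
    by_cases hx : x ∈ closedBall (0 : E) (2 * s)
    · exact (min_le_left _ _).trans (hz hx)
    · rw [hfout x hx]
      rw [mem_closedBall_zero_iff, not_le] at hx
      exact (min_le_right _ _).trans (by linarith)
  let R := 3 * s
  -- Points with `‖f x‖ ≤ R` are pushed to the sphere, the others stay put. The lower bound `m`
  -- makes this Lipschitz.
  let φ : E → ℝ := fun x => max 1 (R / ‖f x‖)
  have hR : 0 < R := by positivity
  have hfpos : ∀ x, 0 < ‖f x‖ := fun x => hm.trans_le (hmf x)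
  have hφ : ∀ x, φ x ≤ 1 + R / m := fun x => by
    have : R / ‖f x‖ ≤ R / m := by gcongr; exact hmf x
    have : 0 ≤ R / m := by positivity
    exact max_le (by linarith) (by linarith)
  have hφ1 : ∀ x, 1 ≤ φ x := fun x => le_max_left _ _
  let h : E → E := fun x => φ x • f x
  have hhL : ∀ x y, dist (h x) (h y) ≤ (R / m + (1 + R / m)) * dist (f x) (f y) := by
    intro x y
    have h1 : h x - h y = (φ x - φ y) • f x + φ y • (f x - f y) := by
      simp only [h]; module
    have h2 : |φ x - φ y| ≤ |R / ‖f x‖ - R / ‖f y‖| := by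
      have := abs_max_sub_max_le_max 1 (R / ‖f x‖) 1 (R / ‖f y‖)
      rwa [sub_self, abs_zero, max_eq_right (a := (0 : ℝ)) (abs_nonneg _)] at this
    have h3 : |R / ‖f x‖ - R / ‖f y‖| * ‖f x‖ ≤ R / m * ‖f x - f y‖ := by
      have hx := hfpos x
      have hy := hfpos y
      have e : R / ‖f x‖ - R / ‖f y‖ = R / ‖f y‖ * (‖f y‖ - ‖f x‖) / ‖f x‖ := by field_simp
      rw [e, abs_div, abs_of_pos hx, div_mul_cancel₀ _ hx.ne', abs_mul,
        abs_of_pos (by positivity : 0 < R / ‖f y‖), norm_sub_rev]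
      gcongr
      · exact hmf y
      · exact abs_norm_sub_norm_le _ _
    rw [dist_eq_norm, dist_eq_norm, h1]
    refine (norm_add_le _ _).trans ?_
    rw [norm_smul, norm_smul, add_mul, Real.norm_eq_abs,
      Real.norm_of_nonneg (zero_le_one.trans (hφ1 y))]
    exact add_le_add ((mul_le_mul_of_nonneg_right h2 (norm_nonneg _)).trans h3)
      (mul_le_mul_of_nonneg_right (hφ y) (norm_nonneg _))
  have hhLip : LipschitzWith ((R / m + (1 + R / m)).toNNReal * (1 + (1 + (L + 1)))) h := by
    refine LipschitzWith.of_dist_le_mul fun x y => (hhL x y).trans ?_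
    rw [NNReal.coe_mul, Real.coe_toNNReal _ (by positivity), mul_assoc]
    gcongr
    exact hfL.dist_le_mul x y
  obtain ⟨x, hx, hxR⟩ := exists_norm_ne_of_lipschitzWith_of_eq_id hhLip hR fun x hx => by
    rw [mem_ball_zero_iff, not_lt] at hx
    have : f x = x := hfout x (by rw [mem_closedBall_zero_iff]; simp only [R] at hx; linarith)
    have hφx : φ x = 1 := by
      simp only [φ, this]
      exact max_eq_left ((div_le_one (by linarith)).2 hx)
    simp [h, hφx, this]
  refine hxR ?_
  have hle : ‖f x‖ ≤ R := by
    by_cases hx2 : x ∈ closedBall (0 : E) (2 * s)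
    · rw [mem_closedBall_zero_iff] at hx2
      calc ‖f x‖ ≤ ‖x‖ + ‖w x‖ := norm_add_le _ _
        _ ≤ 2 * s + s := add_le_add hx2
            ((hwle x).trans (mul_le_of_le_one_left hs.le (hχ1 x)))
        _ = R := by simp only [R]; ring
    · rw [hfout x hx2]
      exact (mem_ball_zero_iff.1 hx).le
  have hφx : φ x = R / ‖f x‖ := max_eq_right ((one_le_div (hfpos x)).2 hle)
  rw [norm_smul, hφx, norm_div, norm_norm, Real.norm_of_nonneg hR.le,
    div_mul_cancel₀ _ (hfpos x).ne']

/-- A Lipschitz map that moves no point of a ball by more than half of the radius attains the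
centre. -/
theorem mem_image_closedBall_of_norm_sub_le {F : E → E} {L : ℝ≥0} (hF : LipschitzWith L F) {s : ℝ}
    (hs : 0 < s) {y : E} (hFs : ∀ x ∈ closedBall y (2 * s), ‖F x - x‖ ≤ s) :
    y ∈ F '' closedBall y (2 * s) := by
  have hG : LipschitzWith (L * 1 + 0) fun x => F (x + y) - y :=
    (hF.comp (LipschitzWith.of_dist_le_mul fun a b => by simp)).sub (LipschitzWith.const y)
  obtain ⟨x, hx, h0⟩ := exists_eq_zero_of_norm_sub_le hG hs fun x hx => by
    have := hFs (x + y) (by simpa using hx)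
    rwa [← sub_sub, sub_right_comm] at this
  exact ⟨x + y, by simpa using hx, sub_eq_zero.1 h0⟩

end Degree


/-! ### From distance Kolmogorov to measure Kolmogorov -/

section MeasureOfDistance

open Metric Set Filter
open scoped NNReal ENNReal Topology

/-- Almost no point of a set is a point of porosity. -/
theorem ae_restrict_eventually_forall_exists_dist_le {E : Type*} [NormedAddCommGroup E]
    [InnerProductSpace ℝ E] [FiniteDimensional ℝ E] [MeasurableSpace E] [BorelSpace E]
    (μ : Measure E) [μ.IsAddHaarMeasure] (K : Set E) {c : ℝ} (hc : 0 < c) :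
    ∀ᵐ y ∂μ.restrict K, ∀ᶠ s in 𝓝[>] (0 : ℝ), ∀ x ∈ closedBall y (2 * s),
      ∃ z ∈ K, dist z x ≤ c * s := by
  filter_upwards [IsUnifLocDoublingMeasure.ae_tendsto_measure_inter_div μ K (2 / c)] with y hy
  by_contra hcon
  rw [not_eventually] at hcon
  push Not at hcon
  let bad : Set ℝ := {s | ∃ x ∈ closedBall y (2 * s), ∀ z ∈ K, c * s < dist z x}
  choose! w hw using fun (s : ℝ) (hs : s ∈ bad) => hs
  let l : Filter ℝ := 𝓝[>] 0 ⊓ 𝓟 bad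
  have hl : l.NeBot := frequently_mem_iff_neBot.1 hcon
  have hδ : Tendsto (fun s : ℝ => c * s) l (𝓝[>] 0) := by
    refine Tendsto.mono_left ?_ inf_le_left
    refine tendsto_nhdsWithin_iff.2 ⟨?_, ?_⟩
    · have : Tendsto (fun s : ℝ => c * s) (𝓝 0) (𝓝 (c * 0)) := tendsto_id.const_mul c
      rw [mul_zero] at this
      exact this.mono_left nhdsWithin_le_nhds
    · filter_upwards [self_mem_nhdsWithin] with s hs
      exact mul_pos hc hs
  have hbad : ∀ᶠ s in l, s ∈ bad := mem_inf_of_right (mem_principal_self _)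
  -- The density theorem is applied to off-centre balls: `w s` is within `2 * s = (2 / c) * (c * s)`
  -- of `y`. These balls miss `K`, so the density would be 0 instead of 1.
  have hlim := hy w (fun s => c * s) hδ (by
    filter_upwards [hbad] with s hs
    have h1 := (hw s hs).1
    rw [mem_closedBall, dist_comm, ← mul_assoc, div_mul_cancel₀ _ hc.ne']
    exact h1)
  have hzero : Tendsto (fun s => μ (K ∩ closedBall (w s) (c * s)) / μ (closedBall (w s) (c * s)))
      l (𝓝 0) := by
    refine tendsto_const_nhds.congr' ?_
    filter_upwards [hbad] with s hs
    have : K ∩ closedBall (w s) (c * s) = ∅ := by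
      rw [eq_empty_iff_forall_notMem]
      rintro z ⟨hzK, hz⟩
      exact absurd hz (not_le.2 ((hw s hs).2 z hzK))
    rw [this, measure_empty, ENNReal.zero_div]
  exact zero_ne_one (tendsto_nhds_unique hzero hlim)

theorem IsDistanceKolmogorov.isMeasureKolmogorov {d : ℕ} {K : Set (EuclideanSpace ℝ (Fin d))}
    (hK : IsCompact K) (h : IsDistanceKolmogorov K) : IsMeasureKolmogorov K := by
  refine ⟨hK.isBounded, hK.measurableSet.nullMeasurableSet, fun ε hε => ?_⟩
  let C : ℝ≥0 := lipschitzExtensionConstant (EuclideanSpace ℝ (Fin d)) * 1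
  -- Chosen so that `(C + 1) * (c * s) = s / 2`: passing to a nearby point of `K` and back costs
  -- half of the allowed displacement `s`, and `f` uses the other half.
  let c : ℝ := 1 / (2 * (C + 1))
  have hc : 0 < c := by positivity
  let η : ℝ≥0 := ε.toNNReal / (C ^ d + 1)
  have hη : 0 < η := div_pos (Real.toNNReal_pos.2 hε) (by positivity)
  have hη0 : (η : ℝ≥0∞) ≠ 0 := by exact_mod_cast hη.ne'
  obtain ⟨O, hKO, hO, hμO⟩ := K.exists_isOpen_lt_add (μ := volume) hK.measure_lt_top.ne hη0
  let Q : EuclideanSpace ℝ (Fin d) → ℝ → Prop := fun y s =>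
    (∀ x ∈ closedBall y (2 * s), ∃ z ∈ K, dist z x ≤ c * s) ∧ closedBall y (2 * s) ⊆ O
  -- Good points at all scales from the `m`th on. One `m`, hence one scale, then serves almost all
  -- of `K`.
  let G : ℕ → Set (EuclideanSpace ℝ (Fin d)) := fun m =>
    {y | ∀ k ≥ m, Q y (1 / ((k : ℝ) + 1))}
  have hGmono : Monotone G := fun m n hmn y hy k hk => hy k (hmn.trans hk)
  have hGae : volume K ≤ volume (⋃ m, G m) := by
    refine measure_mono_ae ?_
    have h1 := ae_imp_of_ae_restrict
      (ae_restrict_eventually_forall_exists_dist_le (volume : Measure (EuclideanSpace ℝ (Fin d)))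
        K hc)
    filter_upwards [h1] with y hy hyK
    have h2 : ∀ᶠ s in 𝓝[>] (0 : ℝ), closedBall y (2 * s) ⊆ O := by
      obtain ⟨r, hr, hrO⟩ := Metric.nhds_basis_closedBall.mem_iff.1 (hO.mem_nhds (hKO hyK))
      filter_upwards [Ioo_mem_nhdsGT (show (0 : ℝ) < r / 2 by positivity)] with s hs
      exact (closedBall_subset_closedBall (by linarith [hs.2])).trans hrO
    have h3 : Tendsto (fun k : ℕ => 1 / ((k : ℝ) + 1)) atTop (𝓝[>] 0) :=
      tendsto_nhdsWithin_iff.2 ⟨tendsto_one_div_add_atTop_nhds_zero_nat,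
        Eventually.of_forall fun k => mem_Ioi.2 Nat.one_div_pos_of_nat⟩
    obtain ⟨m, hm⟩ := eventually_atTop.1 (h3.eventually ((hy hyK).and h2))
    exact mem_iUnion.2 ⟨m, hm⟩
  obtain ⟨m, hm⟩ : ∃ m, volume K < volume (G m) + η := by
    have h1 := (tendsto_measure_iUnion_atTop (μ := volume) hGmono).add_const (η : ℝ≥0∞)
    refine (h1.eventually (lt_mem_nhds ?_)).exists
    exact (ENNReal.lt_add_right hK.measure_lt_top.ne hη0).trans_le (by gcongr)
  let s : ℝ := 1 / ((m : ℝ) + 1)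
  have hs : 0 < s := Nat.one_div_pos_of_nat
  obtain ⟨f, hfL, hfP, hfs⟩ := h.2 (s / 2) (by positivity)
  refine ⟨f, hfL, hfP, ?_⟩
  obtain ⟨F, hF, hfF⟩ := hfL.extend_finite_dimension
  change LipschitzWith C F at hF
  have hGF : G m ⊆ F '' O := by
    intro y hy
    obtain ⟨hy1, hy2⟩ := hy m le_rfl
    refine image_mono hy2 (mem_image_closedBall_of_norm_sub_le hF hs fun x hx => ?_)
    obtain ⟨z, hzK, hz⟩ := hy1 x hx
    have h1 : dist (F x) (F z) ≤ C * (c * s) :=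
      (hF.dist_le_mul x z).trans (by rw [dist_comm]; gcongr)
    have h2 : dist (F z) z ≤ s / 2 := by
      rw [← hfF hzK, dist_eq_norm]; exact hfs z hzK
    have h3 : (C + 1) * (c * s) = s / 2 := by
      simp only [c]; field_simp
    rw [← dist_eq_norm]
    calc dist (F x) x ≤ dist (F x) (F z) + dist (F z) z + dist z x := dist_triangle4 _ _ _ _
      _ ≤ C * (c * s) + s / 2 + c * s := by gcongr
      _ = s := by linarith
  have hOK : volume (O \ K) ≤ η := by
    rw [measure_sdiff hKO hK.measurableSet.nullMeasurableSet hK.measure_lt_top.ne]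
    exact tsub_le_iff_left.2 hμO.le
  have hfK : volume (f '' K) < ∞ := (hK.image_of_continuousOn hfL.continuousOn).measure_lt_top
  have hmain : volume K < volume (f '' K) + (C ^ d * η + η : ℝ≥0) := by
    refine hm.trans_le ?_
    calc volume (G m) + η ≤ volume (F '' K ∪ F '' (O \ K)) + η := by
          rw [← image_union, union_sdiff_cancel hKO]; gcongr
      _ ≤ volume (F '' K) + volume (F '' (O \ K)) + η := by gcongr; exact measure_union_le _ _
      _ ≤ volume (f '' K) + C ^ d * η + η := by
          rw [hfF.image_eq]
          gcongr
          refine (addHaar_image_le_of_lipschitzOnWith volume hF.lipschitzOnWith).trans ?_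
          rw [finrank_euclideanSpace_fin]
          gcongr
      _ = _ := by push_cast; rw [add_assoc]
  have hηε : C ^ d * η + η = ε.toNNReal := by
    simp only [η]
    field_simp
  rw [hηε] at hmain
  have := (ENNReal.toReal_lt_toReal hK.measure_lt_top.ne
    (ENNReal.add_ne_top.2 ⟨hfK.ne, ENNReal.coe_ne_top⟩)).2 hmain
  rw [ENNReal.toReal_add hfK.ne ENNReal.coe_ne_top, ENNReal.coe_toReal,
    Real.coe_toNNReal _ hε.le] at this
  simp only [Measure.real]
  linarith

end MeasureOfDistance


/-! ### Rigidity of volume preserving 1-Lipschitz maps -/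

section Rigidity

open Metric Set Filter
open scoped NNReal ENNReal Topology

variable {E : Type*} [NormedAddCommGroup E] [InnerProductSpace ℝ E] [FiniteDimensional ℝ E]
  [MeasurableSpace E] [BorelSpace E] {μ : Measure E} [μ.IsAddHaarMeasure]

theorem measure_image_le_of_lipschitzOnWith_one {f : E → E} {s : Set E}
    (hf : LipschitzOnWith 1 f s) : μ (f '' s) ≤ μ s := by
  simpa using addHaar_image_le_of_lipschitzOnWith μ hf

/-- The rest of `F` cannot gain measure, so no part can lose any. -/
theorem measure_le_measure_image_of_subset {g : E → E} {F A : Set E} (hg : LipschitzOnWith 1 g F)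
    (hF : μ F ≠ ∞) (hgF : μ F ≤ μ (g '' F)) (hA : MeasurableSet A) (hAF : A ⊆ F) :
    μ A ≤ μ (g '' A) := by
  have h1 : μ A + μ (F \ A) ≤ μ (g '' A) + μ (F \ A) :=
    calc μ A + μ (F \ A) = μ F := by
          have := measure_inter_add_sdiff (μ := μ) F hA
          rwa [inter_eq_right.2 hAF] at this
      _ ≤ μ (g '' A ∪ g '' (F \ A)) := by
          rwa [← image_union, union_sdiff_cancel hAF]
      _ ≤ μ (g '' A) + μ (g '' (F \ A)) := measure_union_le _ _
      _ ≤ μ (g '' A) + μ (F \ A) := by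
          exact add_le_add le_rfl
            (measure_image_le_of_lipschitzOnWith_one (hg.mono sdiff_subset))
  exact (ENNReal.add_le_add_iff_right (measure_ne_top_of_subset sdiff_subset hF)).1 h1

/-- A volume preserving 1-Lipschitz map keeps the distance of the centres of two tangent balls. -/
theorem dist_eq_of_measure_le_measure_image {g : E → E} {F : Set E} (hg : LipschitzOnWith 1 g F)
    (hF : μ F ≠ ∞) (hgF : μ F ≤ μ (g '' F)) {x y : E}
    (hx : closedBall x (dist x y / 2) ⊆ F) (hy : closedBall y (dist x y / 2) ⊆ F) :
    dist (g x) (g y) = dist x y := by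
  set r := dist x y / 2 with hr
  have hr0 : 0 ≤ r := by positivity
  have hxF : x ∈ F := hx (mem_closedBall_self hr0)
  have hyF : y ∈ F := hy (mem_closedBall_self hr0)
  have hle : dist (g x) (g y) ≤ dist x y := by simpa using hg.dist_le_mul x hxF y hyF
  refine hle.antisymm (not_lt.1 fun hlt => ?_)
  have hrpos : 0 < r := by have := dist_nonneg.trans_lt hlt; positivity
  -- If the centres came closer, the balls around their images would overlap in positive measure,
  -- leaving too little room for the image of two disjoint balls.
  have hmid : midpoint ℝ (g x) (g y) ∈ ball (g x) r ∩ ball (g y) r := by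
    constructor
    · rw [mem_ball, dist_midpoint_left]
      norm_num
      linarith
    · rw [mem_ball, dist_midpoint_right]
      norm_num
      linarith
  have hpos : 0 < μ (closedBall (g x) r ∩ closedBall (g y) r) :=
    ((isOpen_ball.inter isOpen_ball).measure_pos μ ⟨_, hmid⟩).trans_le
      (measure_mono (inter_subset_inter ball_subset_closedBall ball_subset_closedBall))
  have hdisj : Disjoint (ball x r) (ball y r) := ball_disjoint_ball (by linarith)
  have hsub : ball x r ∪ ball y r ⊆ F :=
    union_subset (ball_subset_closedBall.trans hx) (ball_subset_closedBall.trans hy)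
  have h1 := measure_le_measure_image_of_subset hg hF hgF
    (measurableSet_ball.union measurableSet_ball) hsub
  have himage : ∀ z, closedBall z r ⊆ F → g '' ball z r ⊆ closedBall (g z) r := by
    rintro z hz _ ⟨w, hw, rfl⟩
    have := hg.dist_le_mul w (hz (ball_subset_closedBall hw)) z (hz (mem_closedBall_self hr0))
    rw [NNReal.coe_one, one_mul] at this
    exact this.trans (mem_ball.1 hw).le
  have h2 : μ (g '' (ball x r ∪ ball y r)) ≤ μ (closedBall (g x) r ∪ closedBall (g y) r) := by
    rw [image_union]
    exact measure_mono (union_subset_union (himage x hx) (himage y hy))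
  have h3 := measure_union_add_inter (μ := μ) (closedBall (g x) r)
    (measurableSet_closedBall (x := g y) (ε := r))
  have hball : ∀ z w : E, μ (closedBall z r) = μ (ball w r) := fun z w => by
    rw [Measure.addHaar_closedBall μ z hr0, Measure.addHaar_ball_of_pos μ w hrpos]
  rw [measure_union hdisj measurableSet_ball] at h1
  rw [hball (g x) x, hball (g y) y] at h3
  have hfin : μ (closedBall (g x) r ∪ closedBall (g y) r) ≠ ∞ :=
    ((isCompact_closedBall _ _).union (isCompact_closedBall _ _)).measure_lt_top.ne
  have h4 := ENNReal.lt_add_right hfin hpos.ne'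
  rw [h3] at h4
  exact absurd (h1.trans h2) (not_le.2 h4)

variable {d : ℕ}

theorem exists_affineIsometryEquiv_of_isometryOn_ball
    {g : EuclideanSpace ℝ (Fin d) → EuclideanSpace ℝ (Fin d)} {p : EuclideanSpace ℝ (Fin d)}
    {r : ℝ} (hr : 0 < r) (hg : ∀ x ∈ ball p r, ∀ y ∈ ball p r, dist (g x) (g y) = dist x y) :
    ∃ T : EuclideanSpace ℝ (Fin d) ≃ᵃⁱ[ℝ] EuclideanSpace ℝ (Fin d), EqOn g T (ball p r) := by
  let u : EuclideanSpace ℝ (Fin d) → EuclideanSpace ℝ (Fin d) := fun v => g (p + v) - g p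
  have hmem : ∀ v ∈ ball (0 : EuclideanSpace ℝ (Fin d)) r, p + v ∈ ball p r := fun v hv => by
    simpa using hv
  have hp : p ∈ ball p r := mem_ball_self hr
  have hnorm : ∀ v ∈ ball (0 : EuclideanSpace ℝ (Fin d)) r, ‖u v‖ = ‖v‖ := fun v hv => by
    have := hg _ (hmem v hv) p hp
    rw [dist_eq_norm, dist_eq_norm, add_sub_cancel_left] at this
    exact this
  have hinner : ∀ v ∈ ball (0 : EuclideanSpace ℝ (Fin d)) r, ∀ w ∈ ball 0 r,
      (inner ℝ (u v) (u w) : ℝ) = inner ℝ v w := fun v hv w hw => by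
    have h1 : ‖u v - u w‖ = ‖v - w‖ := by
      have := hg _ (hmem v hv) _ (hmem w hw)
      rw [dist_eq_norm, dist_eq_norm, add_sub_add_left_eq_sub] at this
      simpa [u] using this
    rw [real_inner_eq_norm_mul_self_add_norm_mul_self_sub_norm_sub_mul_self_div_two, h1,
      hnorm v hv, hnorm w hw,
      -- Polarization: inner products are determined by norms and distances, both preserved by `u`.
      ← real_inner_eq_norm_mul_self_add_norm_mul_self_sub_norm_sub_mul_self_div_two]
  let b := EuclideanSpace.basisFun (Fin d) ℝ
  have hb : ∀ i, (r / 2) • b i ∈ ball (0 : EuclideanSpace ℝ (Fin d)) r := fun i => by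
    rw [mem_ball_zero_iff, norm_smul, b.norm_eq_one, mul_one, Real.norm_of_nonneg (by positivity)]
    linarith
  let e : Fin d → EuclideanSpace ℝ (Fin d) := fun i => (2 / r) • u ((r / 2) • b i)
  have he : Orthonormal ℝ e := by
    rw [orthonormal_iff_ite]
    intro i j
    simp only [e]
    rw [real_inner_smul_left, real_inner_smul_right, hinner _ (hb i) _ (hb j),
      real_inner_smul_left, real_inner_smul_right, orthonormal_iff_ite.1 b.orthonormal i j]
    field_simp
  let b' := OrthonormalBasis.mk he
    (he.linearIndependent.span_eq_top_of_card_eq_finrank' (by simp)).ge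
  have hb' : ∀ i, b' i = e i := fun i => by simp [b']
  let A := b.equiv b' (Equiv.refl _)
  have hA : ∀ i, A (b i) = e i := fun i => by simp [A, hb']
  have huA : ∀ v ∈ ball (0 : EuclideanSpace ℝ (Fin d)) r, u v = A v := fun v hv => by
    refine InnerProductSpace.ext_inner_left_basis (𝕜 := ℝ) b'.toBasis fun i => ?_
    rw [OrthonormalBasis.coe_toBasis, hb', ← hA i, LinearIsometryEquiv.inner_map_map, hA i]
    simp only [e]
    rw [real_inner_smul_left, hinner _ (hb i) _ hv, real_inner_smul_left]
    field_simp
  refine ⟨(AffineIsometryEquiv.vaddConst ℝ p).symm.trans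
    (A.toAffineIsometryEquiv.trans (AffineIsometryEquiv.vaddConst ℝ (g p))), fun x hx => ?_⟩
  have := huA (x - p) (by simpa [dist_eq_norm] using hx)
  simp only [u, add_sub_cancel] at this
  simp [← this]

/-- In polar coordinates the annulus is an interval times a sphere, and the sphere is connected
because `d ≥ 2`. -/
theorem isPreconnected_annulus (hd : 2 ≤ d) {a b : ℝ} (ha : 0 < a) :
    IsPreconnected {x : EuclideanSpace ℝ (Fin d) | a < ‖x‖ ∧ ‖x‖ < b} := by
  have hrank : 1 < Module.rank ℝ (EuclideanSpace ℝ (Fin d)) := by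
    rw [← Module.finrank_eq_rank, finrank_euclideanSpace_fin]
    exact_mod_cast hd
  have h := (isPreconnected_Ioo (a := a) (b := b)).prod
    (isPreconnected_sphere hrank (0 : EuclideanSpace ℝ (Fin d)) 1)
  convert h.image (fun q => q.1 • q.2) (by fun_prop) using 1
  ext x
  constructor
  · rintro ⟨h1, h2⟩
    have hx : ‖x‖ ≠ 0 := (ha.trans h1).ne'
    refine ⟨(‖x‖, ‖x‖⁻¹ • x), ⟨⟨h1, h2⟩, ?_⟩, ?_⟩
    · simp [norm_smul, hx]
    · simp [smul_smul, hx]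
  · rintro ⟨⟨t, v⟩, ⟨⟨h1, h2⟩, hv⟩, rfl⟩
    rw [mem_sphere_zero_iff_norm] at hv
    have : ‖t • v‖ = t := by
      rw [norm_smul, hv, mul_one, Real.norm_of_nonneg (ha.trans h1).le]
    exact ⟨h1.trans_eq this.symm, this.trans_lt h2⟩

/-- Tangent balls give an isometry near each point. The local affine isometries are analytic, so the
identity theorem glues them along a connected set. -/
theorem exists_affineIsometryEquiv_eqOn
    {g : EuclideanSpace ℝ (Fin d) → EuclideanSpace ℝ (Fin d)}
    {F U : Set (EuclideanSpace ℝ (Fin d))} (hg : LipschitzOnWith 1 g F) (hF : volume F ≠ ∞)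
    (hgF : volume F ≤ volume (g '' F)) (hU : IsOpen U) (hUF : U ⊆ F) (hUc : IsPreconnected U)
    (hUne : U.Nonempty) :
    ∃ T : EuclideanSpace ℝ (Fin d) ≃ᵃⁱ[ℝ] EuclideanSpace ℝ (Fin d), EqOn g T U := by
  have hloc : ∀ p ∈ U, ∃ T : EuclideanSpace ℝ (Fin d) ≃ᵃⁱ[ℝ] EuclideanSpace ℝ (Fin d),
      g =ᶠ[𝓝 p] T := by
    intro p hp
    obtain ⟨ρ, hρ, hρU⟩ := Metric.isOpen_iff.1 hU p hp
    have hiso : ∀ x ∈ ball p (ρ / 4), ∀ y ∈ ball p (ρ / 4), dist (g x) (g y) = dist x y := by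
      intro x hx y hy
      have hxy : dist x y < ρ / 2 := by
        have := dist_triangle_right x y p
        rw [mem_ball] at hx hy
        linarith
      rw [mem_ball] at hx hy
      exact dist_eq_of_measure_le_measure_image hg hF hgF
        ((closedBall_subset_ball' (by linarith)).trans (hρU.trans hUF))
        ((closedBall_subset_ball' (by linarith)).trans (hρU.trans hUF))
    obtain ⟨T, hT⟩ := exists_affineIsometryEquiv_of_isometryOn_ball (by positivity) hiso
    exact ⟨T, hT.eventuallyEq_of_mem (ball_mem_nhds p (by positivity))⟩
  have hana : ∀ T : EuclideanSpace ℝ (Fin d) ≃ᵃⁱ[ℝ] EuclideanSpace ℝ (Fin d), ∀ p,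
      AnalyticAt ℝ T p := by
    intro T p
    have : (T : EuclideanSpace ℝ (Fin d) → EuclideanSpace ℝ (Fin d)) = fun x =>
        (T.linearIsometryEquiv.toContinuousLinearEquiv : _ →L[ℝ] _) x + T 0 := by
      ext1 x
      have := T.map_vadd 0 x
      simpa using this
    rw [this]
    exact (ContinuousLinearMap.analyticAt _ p).add analyticAt_const
  obtain ⟨p, hp⟩ := hUne
  obtain ⟨T, hT⟩ := hloc p hp
  refine ⟨T, AnalyticOnNhd.eqOn_of_preconnected_of_eventuallyEq (𝕜 := ℝ) (fun q hq => ?_)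
    (fun q _ => hana T q) hUc hp hT⟩
  obtain ⟨T', hT'⟩ := hloc q hq
  exact (hana T' q).congr hT'.symm

end Rigidity

/-! ### Limits of 1-Lipschitz maps and semicontinuity of image measure -/

section Limit

open Metric Set Filter
open scoped NNReal ENNReal Topology

variable {E : Type*} [NormedAddCommGroup E] [InnerProductSpace ℝ E] [FiniteDimensional ℝ E]

/-- Arzelà–Ascoli along an ultrafilter, which replaces the choice of a subsequence. -/
theorem exists_lipschitzOnWith_tendstoUniformlyOn {K : Set E} (hK : IsCompact K) {x₀ : E}
    (hx₀ : x₀ ∈ K) {f : ℕ → E → E} (hf : ∀ n, LipschitzOnWith 1 (f n) K)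
    (hf0 : ∀ n, f n x₀ = 0) :
    ∃ g : E → E, LipschitzOnWith 1 g K ∧
      TendstoUniformlyOn f g (hyperfilter ℕ : Filter ℕ) K := by
  have hdist : ∀ n, ∀ x ∈ K, ∀ y ∈ K, dist (f n x) (f n y) ≤ dist x y := fun n x hx y hy => by
    simpa using (hf n).dist_le_mul x hx y hy
  have hlim : ∀ x ∈ K, ∃ y, Tendsto (fun n => f n x) (hyperfilter ℕ : Filter ℕ) (𝓝 y) := by
    intro x hx
    obtain ⟨y, -, hy⟩ := (isCompact_closedBall (0 : E) (dist x x₀)).ultrafilter_le_nhds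
      ((hyperfilter ℕ).map fun n => f n x) (by
        rw [le_principal_iff]
        refine mem_map.2 (Eventually.of_forall fun n => ?_)
        rw [mem_closedBall, ← hf0 n]
        exact hdist n x hx x₀ hx₀)
    exact ⟨y, hy⟩
  choose! g hg using hlim
  have hgL : ∀ x ∈ K, ∀ y ∈ K, dist (g x) (g y) ≤ dist x y := fun x hx y hy =>
    le_of_tendsto ((hg x hx).dist (hg y hy)) (Eventually.of_forall fun n => hdist n x hx y hy)
  refine ⟨g, LipschitzOnWith.of_dist_le_mul fun x hx y hy => by simpa using hgL x hx y hy, ?_⟩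
  rw [Metric.tendstoUniformlyOn_iff]
  intro ε hε
  obtain ⟨t, htK, htfin, htcov⟩ := hK.finite_cover_balls (e := ε / 3) (by positivity)
  have hev : ∀ᶠ n in (hyperfilter ℕ : Filter ℕ), ∀ z ∈ t, dist (f n z) (g z) < ε / 3 :=
    (eventually_all_finite htfin).2 fun z hz =>
      (Metric.tendsto_nhds.1 (hg z (htK hz))) _ (by positivity)
  filter_upwards [hev] with n hn x hx
  obtain ⟨z, hz, hxz⟩ := mem_iUnion₂.1 (htcov hx)
  rw [mem_ball] at hxz
  have h1 := hgL x hx z (htK hz)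
  have h2 := hdist n z (htK hz) x hx
  have h3 := hn z hz
  rw [dist_comm] at h3
  rw [dist_comm z x] at h2
  linarith [dist_triangle4 (g x) (g z) (f n z) (f n x)]

/-- The images eventually lie in any thickening of the compact set `g '' F`, and the measures of its
thickenings tend to its own. -/
theorem measure_le_measure_image_of_tendstoUniformlyOn [MeasurableSpace E] [BorelSpace E]
    {μ : Measure E} [IsFiniteMeasureOnCompacts μ] {l : Filter ℕ} [l.NeBot] {F : Set E}
    (hF : IsCompact F) {f : ℕ → E → E} {g : E → E} (hg : ContinuousOn g F)
    (hfg : TendstoUniformlyOn f g l F) {c : ℝ≥0∞} {e : ℕ → ℝ≥0∞} (he : Tendsto e l (𝓝 0))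
    (hc : ∀ n, c ≤ μ (f n '' F) + e n) : c ≤ μ (g '' F) := by
  have hlim := (tendsto_measure_cthickening_of_isCompact (μ := μ) (hF.image_of_continuousOn hg))
  refine ge_of_tendsto (hlim.mono_left (nhdsWithin_le_nhds (s := Ioi 0))) ?_
  filter_upwards [self_mem_nhdsWithin] with δ hδ
  have h1 : Tendsto (fun n => μ (cthickening δ (g '' F)) + e n) l
      (𝓝 (μ (cthickening δ (g '' F)) + 0)) := he.const_add _
  rw [add_zero] at h1
  refine ge_of_tendsto h1 ?_
  filter_upwards [Metric.tendstoUniformlyOn_iff.1 hfg δ hδ] with n hn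
  refine (hc n).trans ?_
  gcongr
  rintro _ ⟨x, hx, rfl⟩
  exact mem_cthickening_of_dist_le _ (g x) _ _ (mem_image_of_mem g hx)
    (by rw [dist_comm]; exact (hn x hx).le)

end Limit


/-! ### From measure Kolmogorov to distance Kolmogorov -/

section DistanceOfMeasure

open Metric Set Filter
open scoped NNReal ENNReal Topology Pointwise

variable {d : ℕ}

theorem IsPolyhedron.image_affineIsometryEquiv {A : Set (EuclideanSpace ℝ (Fin d))}
    (hA : IsPolyhedron A) (T : EuclideanSpace ℝ (Fin d) ≃ᵃⁱ[ℝ] EuclideanSpace ℝ (Fin d)) :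
    IsPolyhedron (T '' A) := by
  obtain ⟨S, hSfin, hS, hAS⟩ := hA
  refine ⟨(fun H => T '' H) '' S, hSfin.image _, ?_, ?_⟩
  · rintro _ ⟨H, hH, rfl⟩
    obtain ⟨v, c, hv, rfl⟩ := hS H hH
    have hT : ∀ x, T x = T.linearIsometryEquiv x + T 0 := fun x => by
      simpa using T.map_vadd 0 x
    refine ⟨T.linearIsometryEquiv v, c + inner ℝ (T.linearIsometryEquiv v) (T 0), by simpa using hv,
      ?_⟩
    ext y
    obtain ⟨x, rfl⟩ := T.surjective y
    rw [T.injective.mem_set_image]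
    change inner ℝ v x = c ↔ inner ℝ _ (T x) = _
    rw [hT x, inner_add_right, LinearIsometryEquiv.inner_map_map, add_left_inj]
  · change frontier (T.toHomeomorph '' A) ⊆ _
    rw [← T.toHomeomorph.image_frontier]
    rintro _ ⟨x, hx, rfl⟩
    obtain ⟨H, hH, hxH⟩ := hAS hx
    exact ⟨T '' H, mem_image_of_mem _ hH, mem_image_of_mem T hxH⟩

/-- As `A ∩ O` is closed, its frontier lies in `O` and so avoids the frontier of `O`; what remains
is in the frontier of `A`. -/
theorem IsPolyhedron.of_inter_isOpen {A O : Set (EuclideanSpace ℝ (Fin d))}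
    (hA : IsPolyhedron A) (hO : IsOpen O) (hAO : IsClosed (A ∩ O)) : IsPolyhedron (A ∩ O) := by
  obtain ⟨S, hSfin, hS, hAS⟩ := hA
  refine ⟨S, hSfin, hS, fun x hx => hAS ?_⟩
  rcases frontier_inter_subset A O hx with h | h
  · exact h.1
  · exact absurd (hAO.frontier_subset hx).2 (hO.frontier_eq ▸ h.2).2

theorem eq_midpoint_of_dist_le {E : Type*} [NormedAddCommGroup E] [NormedSpace ℝ E]
    [StrictConvexSpace ℝ E] {p q w z : E} (hz : z = midpoint ℝ p q) (hp : dist w p ≤ dist z p)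
    (hq : dist w q ≤ dist z q) : w = z := by
  subst hz
  rw [dist_midpoint_left] at hp
  rw [dist_midpoint_right] at hq
  norm_num at hp hq
  have := dist_triangle_left p q w
  refine eq_midpoint_of_dist_eq_half ?_ ?_ <;> [rw [dist_comm]; skip] <;> linarith

theorem isDistanceKolmogorov_of_forall_isMeasureKolmogorov (hd : 2 ≤ d)
    (h : ∀ K : Set (EuclideanSpace ℝ (Fin d)), IsCompact K → IsMeasureKolmogorov K)
    {K : Set (EuclideanSpace ℝ (Fin d))} (hK : IsCompact K) : IsDistanceKolmogorov K := by
  refine ⟨hK.isBounded, fun ε hε => ?_⟩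
  have : NeZero d := ⟨by omega⟩
  obtain ⟨R, hR, hKR⟩ : ∃ R : ℝ, 0 < R ∧ K ⊆ ball 0 R :=
    hK.isBounded.subset_ball_lt 0 0
  let F : Set (EuclideanSpace ℝ (Fin d)) := closedBall 0 (4 * R) \ ball 0 (2 * R)
  let U : Set (EuclideanSpace ℝ (Fin d)) := {x | 2 * R < ‖x‖ ∧ ‖x‖ < 4 * R}
  have hF : IsCompact F := (isCompact_closedBall _ _).diff isOpen_ball
  have hUF : U ⊆ F := fun x hx =>
    ⟨mem_closedBall_zero_iff.2 hx.2.le, fun h => (mem_ball_zero_iff.1 h).not_gt hx.1⟩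
  have hUo : IsOpen U :=
    (isOpen_lt continuous_const continuous_norm).inter (isOpen_lt continuous_norm continuous_const)
  let v : EuclideanSpace ℝ (Fin d) := EuclideanSpace.single 0 1
  have hv : ‖v‖ = 1 := by simp [v]
  have hvR : ‖(3 * R) • v‖ = 3 * R := by
    rw [norm_smul, hv, mul_one, Real.norm_of_nonneg (by positivity)]
  have hvU : (3 * R) • v ∈ U := ⟨by linarith, by linarith⟩
  have hKF : Disjoint K F := disjoint_left.2 fun x hx hxF =>
    hxF.2 (ball_subset_ball (by linarith) (hKR hx))
  have hK' : IsCompact (K ∪ F) := hK.union hF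
  have hx₀ : (3 * R) • v ∈ K ∪ F := Or.inr (hUF hvU)
  choose f hfL hfP hfμ using fun n : ℕ => (h _ hK').2.2 (1 / ((n : ℝ) + 1)) Nat.one_div_pos_of_nat
  have hfF : ∀ n, volume F ≤ volume (f n '' F) + ENNReal.ofReal (1 / ((n : ℝ) + 1)) := by
    intro n
    have h1 := hfμ n
    have hfK' : volume (f n '' (K ∪ F)) ≠ ∞ :=
      (hK'.image_of_continuousOn (hfL n).continuousOn).measure_lt_top.ne
    have h2 : volume K + volume F ≤
        volume (f n '' (K ∪ F)) + ENNReal.ofReal (1 / ((n : ℝ) + 1)) := by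
      rw [← measure_union hKF hF.measurableSet]
      rw [← ENNReal.ofReal_toReal hK'.measure_lt_top.ne, ← ENNReal.ofReal_toReal hfK',
        ← ENNReal.ofReal_add (by positivity) (by positivity)]
      refine ENNReal.ofReal_le_ofReal ?_
      simp only [Measure.real] at h1
      linarith
    -- The image of `K` is no larger than `K`, so the annulus alone loses at most `1 / (n + 1)`.
    have h3 : volume K + volume F ≤
        volume K + (volume (f n '' F) + ENNReal.ofReal (1 / ((n : ℝ) + 1))) := by
      refine h2.trans ?_
      rw [image_union, ← add_assoc]
      refine add_le_add ((measure_union_le _ _).trans (add_le_add ?_ le_rfl)) le_rfl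
      exact measure_image_le_of_lipschitzOnWith_one ((hfL n).mono subset_union_left)
    exact (ENNReal.add_le_add_iff_left hK.measure_lt_top.ne).1 h3
  let S : ℕ → EuclideanSpace ℝ (Fin d) ≃ᵃⁱ[ℝ] EuclideanSpace ℝ (Fin d) := fun n =>
    AffineIsometryEquiv.constVAdd ℝ _ (-(f n ((3 * R) • v)))
  let f' : ℕ → EuclideanSpace ℝ (Fin d) → EuclideanSpace ℝ (Fin d) := fun n x => S n (f n x)
  have hf'L : ∀ n, LipschitzOnWith 1 (f' n) (K ∪ F) := fun n =>
    LipschitzOnWith.of_dist_le_mul fun x hx y hy => by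
      simpa only [f', (S n).dist_map] using (hfL n).dist_le_mul x hx y hy
  have hf'F : ∀ n, volume F ≤ volume (f' n '' F) + ENNReal.ofReal (1 / ((n : ℝ) + 1)) := by
    intro n
    have : f' n '' F = -(f n ((3 * R) • v)) +ᵥ f n '' F := by
      rw [← image_vadd, image_image]; rfl
    rw [this, measure_vadd]
    exact hfF n
  obtain ⟨g, hgL, hfg⟩ := exists_lipschitzOnWith_tendstoUniformlyOn hK' hx₀ hf'L
    fun n => by simp [f', S]
  have hgFL : LipschitzOnWith 1 g F := hgL.mono subset_union_right
  have he : Tendsto (fun n : ℕ => ENNReal.ofReal (1 / ((n : ℝ) + 1)))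
      (hyperfilter ℕ : Filter ℕ) (𝓝 0) := by
    have := ENNReal.tendsto_ofReal tendsto_one_div_add_atTop_nhds_zero_nat
    rw [ENNReal.ofReal_zero] at this
    exact this.mono_left Nat.hyperfilter_le_atTop
  have hgF : volume F ≤ volume (g '' F) :=
    measure_le_measure_image_of_tendstoUniformlyOn hF hgFL.continuousOn
      (hfg.mono subset_union_right) he hf'F
  obtain ⟨T, hT⟩ := exists_affineIsometryEquiv_eqOn hgFL hF.measure_lt_top.ne hgF hUo hUF
    (isPreconnected_annulus hd (by positivity)) ⟨_, hvU⟩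
  let k : EuclideanSpace ℝ (Fin d) → EuclideanSpace ℝ (Fin d) := fun x => T.symm (g x)
  have hkL : ∀ x ∈ K ∪ F, ∀ y ∈ K ∪ F, dist (k x) (k y) ≤ dist x y := fun x hx y hy => by
    simpa [k] using hgL.dist_le_mul x hx y hy
  have hkU : ∀ x ∈ U, k x = x := fun x hx => by simp [k, hT hx]
  have hkK : ∀ x ∈ K, k x = x := by
    intro z hz
    have hzR := mem_ball_zero_iff.1 (hKR hz)
    -- `z` is the midpoint of `z ± (3 * R) • v`; both lie in the annulus since `‖z‖ < R`, and both
    -- are fixed by `k`.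
    have hmem : ∀ w : EuclideanSpace ℝ (Fin d), ‖w‖ = 3 * R → z + w ∈ U := fun w hw => by
      have h1 := norm_add_le z w
      have h2 := norm_sub_norm_le w (-z)
      rw [sub_neg_eq_add, norm_neg, add_comm w z] at h2
      exact ⟨by linarith, by linarith⟩
    have hp := hmem ((3 * R) • v) hvR
    have hq := hmem (-((3 * R) • v)) (by rw [norm_neg, hvR])
    refine eq_midpoint_of_dist_le (p := z + (3 * R) • v) (q := z + -((3 * R) • v)) ?_ ?_ ?_
    · rw [midpoint_eq_smul_add, invOf_eq_inv]; module
    · have := hkL z (Or.inl hz) _ (Or.inr (hUF hp))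
      rwa [hkU _ hp] at this
    · have := hkL z (Or.inl hz) _ (Or.inr (hUF hq))
      rwa [hkU _ hq] at this
  have hkF : ∀ x ∈ F, 2 * R ≤ ‖k x‖ := by
    intro x hx
    have h1 : ‖x‖ ≤ 4 * R := mem_closedBall_zero_iff.1 hx.1
    have h2 : 2 * R ≤ ‖x‖ := not_lt.1 fun h => hx.2 (mem_ball_zero_iff.2 h)
    have hx0 : 0 < ‖x‖ := by linarith
    -- `F` contains its boundary spheres, where `k` is not known to be the identity. Comparison with
    -- the fixed point `y` of norm `3 * R` at distance at most `R` suffices.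
    let y := (3 * R / ‖x‖) • x
    have hy : ‖y‖ = 3 * R := by
      rw [norm_smul, Real.norm_of_nonneg (by positivity), div_mul_cancel₀ _ hx0.ne']
    have hyU : y ∈ U := ⟨by linarith, by linarith⟩
    have hxy : dist x y ≤ R := by
      have : x - y = (1 - 3 * R / ‖x‖) • x := by simp only [y]; module
      have h3 : (1 - 3 * R / ‖x‖) * ‖x‖ = ‖x‖ - 3 * R := by field_simp
      rw [dist_eq_norm, this, norm_smul, Real.norm_eq_abs, ← abs_of_pos hx0, ← abs_mul,
        abs_of_pos hx0, h3, abs_le]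
      constructor <;> linarith
    have h4 := hkL x (Or.inr hx) y (Or.inr (hUF hyU))
    rw [hkU y hyU, dist_eq_norm] at h4
    have h5 := norm_sub_norm_le y (k x)
    rw [norm_sub_rev] at h5
    linarith
  obtain ⟨n, hn⟩ := (Metric.tendstoUniformlyOn_iff.1 hfg (min ε (R / 2)) (by positivity)).exists
  let p : EuclideanSpace ℝ (Fin d) → EuclideanSpace ℝ (Fin d) := fun x => T.symm (f' n x)
  have hpL : LipschitzOnWith 1 p (K ∪ F) :=
    LipschitzOnWith.of_dist_le_mul fun x hx y hy => by
      simpa only [p, T.symm.dist_map] using (hf'L n).dist_le_mul x hx y hy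
  have hpk : ∀ x ∈ K ∪ F, dist (k x) (p x) < min ε (R / 2) := fun x hx => by
    simpa [k, p] using hn x hx
  have hpP : IsPolyhedron (p '' (K ∪ F)) := by
    have := ((hfP n).image_affineIsometryEquiv (S n)).image_affineIsometryEquiv T.symm
    rwa [image_image, image_image] at this
  -- An error below `R / 2` keeps the image of `K` inside radius `3 * R / 2` and that of `F`
  -- outside.
  have hpK : p '' (K ∪ F) ∩ ball 0 (3 * R / 2) = p '' K := by
    apply Subset.antisymm
    · rintro _ ⟨⟨x, hx | hx, rfl⟩, hb⟩
      · exact mem_image_of_mem p hx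
      · have h1 := (hpk x (Or.inr hx)).trans_le (min_le_right _ _)
        have h2 := hkF x hx
        rw [mem_ball_zero_iff] at hb
        rw [dist_eq_norm] at h1
        linarith [norm_sub_norm_le (k x) (p x)]
    · rintro _ ⟨x, hx, rfl⟩
      refine ⟨mem_image_of_mem p (Or.inl hx), ?_⟩
      have h1 := (hpk x (Or.inl hx)).trans_le (min_le_right _ _)
      have h2 := mem_ball_zero_iff.1 (hKR hx)
      rw [hkK x hx, dist_comm, dist_eq_norm] at h1
      rw [mem_ball_zero_iff]
      linarith [norm_sub_norm_le (p x) x]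
  have hpKL : LipschitzOnWith 1 p K := hpL.mono subset_union_left
  refine ⟨p, hpKL, ?_, fun x hx => ?_⟩
  · rw [← hpK]
    refine hpP.of_inter_isOpen isOpen_ball ?_
    rw [hpK]
    exact (hK.image_of_continuousOn hpKL.continuousOn).isClosed
  · have := (hpk x (Or.inl hx)).trans_le (min_le_left _ _)
    rw [hkK x hx, dist_comm, dist_eq_norm] at this
    exact this.le

end DistanceOfMeasure

end KolmogorovProblem


theorem mainTheorem3 (d : ℕ) (hd : 2 ≤ d) :
    (∀ K : Set (EuclideanSpace ℝ (Fin d)), IsCompact K →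
        KolmogorovProblem.IsMeasureKolmogorov K) ↔
      (∀ K : Set (EuclideanSpace ℝ (Fin d)), IsCompact K →
        KolmogorovProblem.IsDistanceKolmogorov K) :=
  ⟨fun h _ hK =>
      KolmogorovProblem.isDistanceKolmogorov_of_forall_isMeasureKolmogorov hd h hK,
    fun h K hK => (h K hK).isMeasureKolmogorov hK⟩
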